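/- Let $r\ge 0$ and let all parameters $A,A',B,B',C,C',C''$ be matrices in $\mathbb C^{r\times r}$, $I$ the identity. For $k\in\mathbb Z$ let $(A)_k$ be the matrix Pochhammer symbol: $(A)_0=I$, $(A)_n=A(A+I)\cdots(A+(n-1)I)$ and $(A)_{-n}=(-1)^n\,\big((I-A)_n\big)^{-1}$ for $n\ge1$; write $(A)_k^{-1}$ for the inverse of $(A)_k$. For $|t|<1$ put $(1-t)^{-P}=\exp(-P\log(1-t))$ with the principal logarithm. Each of the following functions of $x,y\in\mathbb C$ is a double power series $\sum_{m,n\ge0}c_{m,n}\frac{x^my^n}{m!\,n!}$ with the matrix coefficients $c_{m,n}$ (products in the written order): - $G_2(A,A',B,B';x,y)$: $(A)_m(A')_n(B)_{n-m}(B')_{m-n}$; - $G_3(A,A';x,y)$: $(A)_{2n-m}(A')_{2m-n}$; - $H_1(A,B,C;C';x,y)$: $(A)_{m-n}(B)_{m+n}(C)_n(C')_m^{-1}$; - $H_2(A,B,C,C';C'';x,y)$: $(A)_{m-n}(B)_m(C)_n(C')_n(C'')_m^{-1}$; - $H_3(A,B;C;x,y)$: $(A)_{2m+n}(B)_n(C)_{m+n}^{-1}$;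 - $H_4(A,B;C,C';x,y)$: $(A)_{2m+n}(B)_n(C)_m^{-1}(C')_n^{-1}$; - $H_5(A,B;C;x,y)$: $(A)_{2m+n}(B)_{n-m}(C)_n^{-1}$; - $H_6(A,B;C;x,y)$: $(A)_{2m-n}(B)_{n-m}(C)_n$; - $H_7(A,B;C,C';x,y)$: $(A)_{2m-n}(B)_n(C)_n(C')_m^{-1}$; - $\Gamma_1(A,B,B';x,y)$: $(A)_m(B)_{n-m}(B')_{m-n}$; - $\Gamma_2(B,B';x,y)$: $(B)_{n-m}(B')_{m-n}$; - $\mathcal H_1(A,B;C;x,y)$: $(A)_{m-n}(B)_{m+n}(C)_m^{-1}$; - $\mathcal H_2(A,B,B';C;x,y)$: $(A)_{m-n}(B)_m(B')_n(C)_m^{-1}$; - $\mathcal H_3(A,B;C;x,y)$: $(A)_{m-n}(B)_m(C)_m^{-1}$; - $\mathcal H_4(A,B';C;x,y)$: $(A)_{m-n}(B')_n(C)_m^{-1}$; - $\mathcal H_5(A;C;x,y)$: $(A)_{m-n}(C)_m^{-1}$; - $\mathcal H_6(A;C;x,y)$: $(A)_{2m+n}(C)_{m+n}^{-1}$; - $\mathcal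 H_7(A;C,C';x,y)$: $(A)_{2m+n}(C)_m^{-1}(C')_n^{-1}$; - $\mathcal H_8(A,B;x,y)$: $(A)_{2m-n}(B)_{n-m}$; - $\mathcal H_9(A,B;C;x,y)$: $(A)_{2m-n}(B)_n(C)_m^{-1}$; - $\mathcal H_{10}(A;C;x,y)$: $(A)_{2m-n}(C)_m^{-1}$; - $\mathcal H_{11}(A,B,C;C';x,y)$: $(A)_{m-n}(B)_n(C)_n(C')_m^{-1}$. The domain of convergence of such a series is the open set of the $(x,y)$ for which the series converges absolutely at some $(R,S)$ with $R>|x|$, $S>|y|$. Standing assumptions, which say that all the symbols are defined: a parameter $Q$ that occurs through $(Q)_k^{-1}$ has $Q+kI$ invertible for all integers $k\ge0$; a parameter $Q$ that occurs through a Pochhammer symbol with index $m-n$, $n-m$, $2m-n$ or $2n-m$ has $Q-kI$ invertible for all integers $k\ge1$, and $Q+jI$ invertible for all $j\in\mathbb Z$ in a formula in which $Q$ is shifted to $Q+nI$. For a function $F$, one of its parameters $P$ and integers $a,b$, let $\mathrm L(F,P;a,b)$ be the formula $$(1-t)^{-P}\,F\big(P;\,x(1-t)^a,\,y(1-t)^b\big)=\sum_{n=0}^\infty\frac{(P)_n}{n!}\,F(P+nI;\,x,y)\,t^n,$$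 and let $\mathrm R(F,P;a,b)$ be the formula $$F\big(P;\,x(1-t)^a,\,y(1-t)^b\big)\,(1-t)^{-P}=\sum_{n=0}^\infty F(P+nI;\,x,y)\,\frac{(P)_n}{n!}\,t^n,$$ the other parameters being fixed. Each is asserted for all $x,y,t\in\mathbb C$ with $|t|<1$ such that $(x(1-s)^a,y(1-s)^b)$ lies in the domain of convergence of $F(P)$ whenever $|s|\le|t|$ and, for those $n$ (if any) for which $(P)_n$ is singular, $(x,y)$ lies in the domain of convergence of $F(P+nI)$. It is part of the assertion that then $(x,y)$ lies in the domain of convergence of $F(P+nI)$ for every $n\ge 0$ and that the series over $n$ converges. The following formulae hold, each under the commutativity stated with it. - $\mathrm L(G_2,A;-1,0)$; $\mathrm L(G_2,A';0,-1)$ if $AA'=A'A$; $\mathrm R(G_2,B;1,-1)$ if $BB'=B'B$; $\mathrm R(G_2,B';-1,1)$. - $\mathrm L(G_3,A;1,-2)$; $\mathrm R(G_3,A';-2,1)$. - $\mathrm L(H_1,A;-1,1)$; $\mathrm L(H_1,B;-1,-1)$ if $AB=BA$; $\mathrm R(H_1,C;0,-1)$ if $CC'=C'C$. - $\mathrm L(H_2,A;-1,1)$;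 $\mathrm L(H_2,B;-1,0)$ if $AB=BA$; $\mathrm R(H_2,C;0,-1)$ if $CC'=C'C$ and $CC''=C''C$; $\mathrm R(H_2,C';0,-1)$ if $C'C''=C''C'$. - $\mathrm L(H_3,A;-2,-1)$; $\mathrm L(H_3,B;0,-1)$ if $AB=BA$. - $\mathrm L(H_4,A;-2,-1)$; $\mathrm L(H_4,B;0,-1)$ if $AB=BA$. - $\mathrm L(H_5,A;-2,-1)$; $\mathrm L(H_5,B;1,-1)$ if $AB=BA$. - $\mathrm L(H_6,A;-2,1)$; $\mathrm L(H_6,B;1,-1)$ if $AB=BA$. - $\mathrm L(H_7,A;-2,1)$; $\mathrm L(H_7,B;0,-1)$ if $AB=BA$; $\mathrm R(H_7,C;0,-1)$ if $CC'=C'C$. - $\mathrm L(\Gamma_1,A;-1,0)$; $\mathrm R(\Gamma_1,B;1,-1)$ if $BB'=B'B$; $\mathrm R(\Gamma_1,B';-1,1)$. - $\mathrm L(\Gamma_2,B;1,-1)$; $\mathrm R(\Gamma_2,B';-1,1)$. - $\mathrm L(\mathcal H_1,A;-1,1)$; $\mathrm L(\mathcal H_1,B;-1,-1)$ if $AB=BA$.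 - $\mathrm L(\mathcal H_2,A;-1,1)$; $\mathrm L(\mathcal H_2,B;-1,0)$ if $AB=BA$; $\mathrm R(\mathcal H_2,B';0,-1)$ if $B'C=CB'$. - $\mathrm L(\mathcal H_3,A;-1,1)$; $\mathrm L(\mathcal H_3,B;-1,0)$ if $AB=BA$. - $\mathrm L(\mathcal H_4,A;-1,1)$; $\mathrm L(\mathcal H_4,B';0,-1)$ if $AB'=B'A$. - $\mathrm L(\mathcal H_5,A;-1,1)$. - $\mathrm L(\mathcal H_6,A;-2,-1)$. - $\mathrm L(\mathcal H_7,A;-2,-1)$. - $\mathrm L(\mathcal H_8,A;-2,1)$; $\mathrm R(\mathcal H_8,B;1,-1)$. - $\mathrm L(\mathcal H_9,A;-2,1)$; $\mathrm L(\mathcal H_9,B;0,-1)$ if $AB=BA$. - $\mathrm L(\mathcal H_{10},A;-2,1)$. - $\mathrm L(\mathcal H_{11},A;-1,1)$; $\mathrm L(\mathcal H_{11},B;0,-1)$ if $AB=BA$; $\mathrm R(\mathcal H_{11},C;0,-1)$ if $CC'=C'C$. -/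

import Mathlib

open scoped Nat

namespace HornMatrix

/-- Square complex matrices of size `r`. -/
abbrev Mat (r : ℕ) : Type := Matrix (Fin r) (Fin r) ℂ

/-- The matrix Pochhammer symbol `(A)_k` for `k ∈ ℤ`:
`(A)_n = A (A + I) ⋯ (A + (n-1) I)` for `n ≥ 0`, and `(A)_{-n} = (-1)^n ((I - A)_n)⁻¹` for `n ≥ 1`. -/
noncomputable def poch {r : ℕ} (A : Mat r) : ℤ → Mat r
  | Int.ofNat n => Polynomial.aeval A (ascPochhammer ℂ n)
  | Int.negSucc n =>
      ((-1 : ℂ) ^ (n + 1)) • (Polynomial.aeval (1 - A) (ascPochhammer ℂ (n + 1)))⁻¹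

theorem poch_zero {r : ℕ} (A : Mat r) : poch A 0 = 1 := by
  change Polynomial.aeval A (ascPochhammer ℂ 0) = 1
  simp

theorem poch_succ {r : ℕ} (A : Mat r) (n : ℕ) :
    poch A ((n + 1 : ℕ) : ℤ) = poch A (n : ℤ) * (A + (n : ℂ) • (1 : Mat r)) := by
  change Polynomial.aeval A (ascPochhammer ℂ (n + 1)) =
    Polynomial.aeval A (ascPochhammer ℂ n) * _
  rw [ascPochhammer_succ_right, map_mul, map_add, Polynomial.aeval_X, map_natCast]
  congr 2
  rw [← nsmul_one, ← Nat.cast_smul_eq_nsmul ℂ]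

/-- `C + k I` is invertible for every integer `k ≥ 0`, so that every `(C)_k`, `k ≥ 0`,
is invertible. -/
def NonnegRegular {r : ℕ} (C : Mat r) : Prop :=
  ∀ k : ℕ, IsUnit (C + (k : ℂ) • (1 : Mat r))

/-- `A - k I` is invertible for every integer `k ≥ 1`: exactly what is needed for `(A)_{-k}`,
`k ≥ 1`, to make sense. -/
def NegRegular {r : ℕ} (A : Mat r) : Prop :=
  ∀ k : ℕ, 1 ≤ k → IsUnit (A - (k : ℂ) • (1 : Mat r))

/-- `P + j I` is invertible for every integer `j`: exactly what is needed for `(P + n I)_{-k}`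
to make sense for all `n ≥ 0` and `k ≥ 1`. -/
def IntRegular {r : ℕ} (P : Mat r) : Prop :=
  ∀ j : ℤ, IsUnit (P + (j : ℂ) • (1 : Mat r))

/-- The double power series `∑_{m,n ≥ 0} c m n * x^m y^n / (m! n!)` with matrix coefficients,
given by its array `c`. -/
def DoubleSeries (r : ℕ) : Type := ℕ → ℕ → Mat r

/-- The sum of the double power series at `(x, y)`. -/
noncomputable def DoubleSeries.eval {r : ℕ} (c : DoubleSeries r) (x y : ℂ) : Mat r :=
  ∑' p : ℕ × ℕ, (x ^ p.1 * y ^ p.2 / ((p.1 ! : ℂ) * (p.2 ! : ℂ))) • c p.1 p.2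

/-- The (open) domain of convergence of the double power series: the points `(x, y)` for which the
series converges absolutely at some `(R, S)` with `|x| < R` and `|y| < S`. -/
def DoubleSeries.domain {r : ℕ} (c : DoubleSeries r) : Set (ℂ × ℂ) :=
  {z | ∃ R S : ℝ, ‖z.1‖ < R ∧ ‖z.2‖ < S ∧ ∀ i j : Fin r,
    Summable fun p : ℕ × ℕ => R ^ p.1 * S ^ p.2 / ((p.1 ! : ℝ) * (p.2 ! : ℝ)) * ‖c p.1 p.2 i j‖}

section Functions

variable {r : ℕ}

/-- `G₂(A, A', B, B'; x, y)`. -/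
noncomputable def G2 (A A' B B' : Mat r) : DoubleSeries r := fun m n =>
  poch A m * poch A' n * poch B ((n : ℤ) - m) * poch B' ((m : ℤ) - n)

/-- `G₃(A, A'; x, y)`. -/
noncomputable def G3 (A A' : Mat r) : DoubleSeries r := fun m n =>
  poch A (2 * (n : ℤ) - m) * poch A' (2 * (m : ℤ) - n)

/-- `H₁(A, B, C; C'; x, y)`. -/
noncomputable def H1 (A B C C' : Mat r) : DoubleSeries r := fun m n =>
  poch A ((m : ℤ) - n) * poch B ((m : ℤ) + n) * poch C n * (poch C' m)⁻¹

/-- `H₂(A, B, C, C'; C''; x, y)`. -/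
noncomputable def H2 (A B C C' C'' : Mat r) : DoubleSeries r := fun m n =>
  poch A ((m : ℤ) - n) * poch B m * poch C n * poch C' n * (poch C'' m)⁻¹

/-- `H₃(A, B; C; x, y)`. -/
noncomputable def H3 (A B C : Mat r) : DoubleSeries r := fun m n =>
  poch A (2 * (m : ℤ) + n) * poch B n * (poch C ((m : ℤ) + n))⁻¹

/-- `H₄(A, B; C, C'; x, y)`. -/
noncomputable def H4 (A B C C' : Mat r) : DoubleSeries r := fun m n =>
  poch A (2 * (m : ℤ) + n) * poch B n * (poch C m)⁻¹ * (poch C' n)⁻¹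

/-- `H₅(A, B; C; x, y)`. -/
noncomputable def H5 (A B C : Mat r) : DoubleSeries r := fun m n =>
  poch A (2 * (m : ℤ) + n) * poch B ((n : ℤ) - m) * (poch C n)⁻¹

/-- `H₆(A, B; C; x, y)`. -/
noncomputable def H6 (A B C : Mat r) : DoubleSeries r := fun m n =>
  poch A (2 * (m : ℤ) - n) * poch B ((n : ℤ) - m) * poch C n

/-- `H₇(A, B; C, C'; x, y)`. -/
noncomputable def H7 (A B C C' : Mat r) : DoubleSeries r := fun m n =>
  poch A (2 * (m : ℤ) - n) * poch B n * poch C n * (poch C' m)⁻¹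

/-- `Γ₁(A, B, B'; x, y)`. -/
noncomputable def Gamma1 (A B B' : Mat r) : DoubleSeries r := fun m n =>
  poch A m * poch B ((n : ℤ) - m) * poch B' ((m : ℤ) - n)

/-- `Γ₂(B, B'; x, y)`. -/
noncomputable def Gamma2 (B B' : Mat r) : DoubleSeries r := fun m n =>
  poch B ((n : ℤ) - m) * poch B' ((m : ℤ) - n)

/-- `ℋ₁(A, B; C; x, y)`. -/
noncomputable def calH1 (A B C : Mat r) : DoubleSeries r := fun m n =>
  poch A ((m : ℤ) - n) * poch B ((m : ℤ) + n) * (poch C m)⁻¹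

/-- `ℋ₂(A, B, B'; C; x, y)`. -/
noncomputable def calH2 (A B B' C : Mat r) : DoubleSeries r := fun m n =>
  poch A ((m : ℤ) - n) * poch B m * poch B' n * (poch C m)⁻¹

/-- `ℋ₃(A, B; C; x, y)`. -/
noncomputable def calH3 (A B C : Mat r) : DoubleSeries r := fun m n =>
  poch A ((m : ℤ) - n) * poch B m * (poch C m)⁻¹

/-- `ℋ₄(A, B'; C; x, y)`. -/
noncomputable def calH4 (A B' C : Mat r) : DoubleSeries r := fun m n =>
  poch A ((m : ℤ) - n) * poch B' n * (poch C m)⁻¹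

/-- `ℋ₅(A; C; x, y)`. -/
noncomputable def calH5 (A C : Mat r) : DoubleSeries r := fun m n =>
  poch A ((m : ℤ) - n) * (poch C m)⁻¹

/-- `ℋ₆(A; C; x, y)`. -/
noncomputable def calH6 (A C : Mat r) : DoubleSeries r := fun m n =>
  poch A (2 * (m : ℤ) + n) * (poch C ((m : ℤ) + n))⁻¹

/-- `ℋ₇(A; C, C'; x, y)`. -/
noncomputable def calH7 (A C C' : Mat r) : DoubleSeries r := fun m n =>
  poch A (2 * (m : ℤ) + n) * (poch C m)⁻¹ * (poch C' n)⁻¹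

/-- `ℋ₈(A, B; x, y)`. -/
noncomputable def calH8 (A B : Mat r) : DoubleSeries r := fun m n =>
  poch A (2 * (m : ℤ) - n) * poch B ((n : ℤ) - m)

/-- `ℋ₉(A, B; C; x, y)`. -/
noncomputable def calH9 (A B C : Mat r) : DoubleSeries r := fun m n =>
  poch A (2 * (m : ℤ) - n) * poch B n * (poch C m)⁻¹

/-- `ℋ₁₀(A; C; x, y)`. -/
noncomputable def calH10 (A C : Mat r) : DoubleSeries r := fun m n =>
  poch A (2 * (m : ℤ) - n) * (poch C m)⁻¹

/-- `ℋ₁₁(A, B, C; C'; x, y)`. -/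
noncomputable def calH11 (A B C C' : Mat r) : DoubleSeries r := fun m n =>
  poch A ((m : ℤ) - n) * poch B n * poch C n * (poch C' m)⁻¹

end Functions

/-- `(1 - t)^{-P} = exp (-P log (1 - t))`, with the principal logarithm. -/
noncomputable def oneSubPowNeg {r : ℕ} (t : ℂ) (P : Mat r) : Mat r :=
  NormedSpace.exp ((-Complex.log (1 - t)) • P)

/-- The arguments are admissible for the summation formula in the parameter `P` of the matrix
function `F`, with rescaled arguments `x (1 - t)^a` and `y (1 - t)^b`: `|t| < 1`, the arguments
rescaled by any `s` in the disc `|s| ≤ |t|` lie in the domain of convergence of `F(P)`, and, in the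
degenerate case that some `(P)_n` is singular, `(x, y)` lies in the domain of convergence of
`F(P + nI)` for these `n`. -/
def Admissible {r : ℕ} (F : Mat r → DoubleSeries r) (P : Mat r) (a b : ℤ) (x y t : ℂ) : Prop :=
  ‖t‖ < 1 ∧
  (∀ s : ℂ, ‖s‖ ≤ ‖t‖ → (x * (1 - s) ^ a, y * (1 - s) ^ b) ∈ (F P).domain) ∧
  (∀ n : ℕ, ¬ IsUnit (poch P n) → (x, y) ∈ (F (P + (n : ℂ) • (1 : Mat r))).domain)

/-- `(1 - t)^{-P} F(P; x (1 - t)^a, y (1 - t)^b) = ∑_n (P)_n / n! * F(P + nI; x, y) t^n`,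
where all the series converge. -/
def LeftFormula {r : ℕ} (F : Mat r → DoubleSeries r) (P : Mat r) (a b : ℤ) : Prop :=
  ∀ x y t : ℂ, Admissible F P a b x y t →
    (∀ n : ℕ, (x, y) ∈ (F (P + (n : ℂ) • (1 : Mat r))).domain) ∧
    HasSum
      (fun n : ℕ => (t ^ n / (n ! : ℂ)) •
        (poch P n * (F (P + (n : ℂ) • (1 : Mat r))).eval x y))
      (oneSubPowNeg t P * (F P).eval (x * (1 - t) ^ a) (y * (1 - t) ^ b))

/-- `F(P; x (1 - t)^a, y (1 - t)^b) (1 - t)^{-P} = ∑_n F(P + nI; x, y) * (P)_n / n! t^n`,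
where all the series converge. -/
def RightFormula {r : ℕ} (F : Mat r → DoubleSeries r) (P : Mat r) (a b : ℤ) : Prop :=
  ∀ x y t : ℂ, Admissible F P a b x y t →
    (∀ n : ℕ, (x, y) ∈ (F (P + (n : ℂ) • (1 : Mat r))).domain) ∧
    HasSum
      (fun n : ℕ => (t ^ n / (n ! : ℂ)) •
        ((F (P + (n : ℂ) • (1 : Mat r))).eval x y * poch P n))
      ((F P).eval (x * (1 - t) ^ a) (y * (1 - t) ^ b) * oneSubPowNeg t P)

end HornMatrix

open HornMatrix

/-!
The identity `(P)_N (P + N)_j = (P + j)_N (P)_j`, for `j = -(am + bn)`, turns `(P)_N` times the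
`(m, n)`-th coefficient of `F(P + N)` into `(P - (am + bn))_N` times that of `F(P)`, since the
factors standing between `(P)_N` and the symbol in `P` commute with `P`. Summing over `N` first, the
binomial series of `(1 - t)^{-(P - (am + bn))} = (1 - t)^{am + bn} (1 - t)^{-P}` produces exactly
the rescaling `x (1 - t)^a, y (1 - t)^b`.

The order of summation may be exchanged because Pascal's recurrence bounds the absolute binomial
series at `P - k` by `(1 - |t|)^k + (1 + |t|)^k` times the one at `P`, and with `k = am + bn` these
weights are those of the double series rescaled by `s = |t|` and `s = -|t|`. The same bound for a
small `t` shows that the domain of convergence does not shrink from `F(P)` to `F(P + N)` when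
`(P)_N` is invertible. Transposition of matrices turns right multiplication into left
multiplication.
-/

namespace HornMatrix

open scoped Matrix

section Rising

variable {R : Type*}

section Semiring

variable [Semiring R]

/-- The rising factorial `P (P + 1) ⋯ (P + (n - 1))` of an element of a possibly noncommutative
semiring. -/
noncomputable def rising (P : R) (n : ℕ) : R := (ascPochhammer ℕ n).smeval P

@[simp]
theorem rising_zero (P : R) : rising P 0 = 1 := by
  simp [rising]

@[simp]
theorem rising_one (P : R) : rising P 1 = P := by
  simp [rising]

theorem rising_add (P : R) (m n : ℕ) : rising P (m + n) = rising P m * rising (P + m) n := by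
  simp only [rising, ← ascPochhammer_mul, Polynomial.smeval_mul, Polynomial.smeval_comp,
    Polynomial.smeval_add, Polynomial.smeval_X, Polynomial.smeval_natCast, pow_one, pow_zero,
    nsmul_one]

theorem rising_succ (P : R) (n : ℕ) : rising P (n + 1) = rising P n * (P + n) := by
  rw [rising_add, rising_one]

theorem commute_rising {P X : R} (h : Commute P X) (n : ℕ) : Commute (rising P n) X :=
  Polynomial.smeval_commute_left ℕ (ascPochhammer ℕ n) h

theorem rising_succ' (P : R) (n : ℕ) : rising P (n + 1) = rising (P + 1) n * P := by
  rw [add_comm n 1, rising_add, rising_one, Nat.cast_one,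
    (commute_rising ((Commute.refl P).add_left (Commute.one_left P)) n).eq]

theorem rising_add_one_succ (P : R) (n : ℕ) :
    rising (P + 1) (n + 1) = rising P (n + 1) + (n + 1) • rising (P + 1) n := by
  rw [rising_succ, rising_succ', nsmul_eq_mul, Nat.cast_comm, ← mul_add, add_assoc,
    add_comm 1 (n : R), Nat.cast_succ]

theorem isUnit_rising {P : R} (h : ∀ i : ℕ, IsUnit (P + i)) (n : ℕ) : IsUnit (rising P n) := by
  induction n with
  | zero => simp
  | succ n ih => exact rising_succ P n ▸ ih.mul (h n)

theorem commute_rising_add_rising (P : R) (m n : ℕ) : Commute (rising (P + m) n) (rising P m) :=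
  commute_rising (commute_rising ((Commute.refl P).add_right (Nat.commute_cast P m)) m).symm n

theorem rising_add_mul_rising (P : R) (m n : ℕ) :
    rising (P + m) n * rising P m = rising (P + n) m * rising P n := by
  rw [(commute_rising_add_rising P m n).eq, ← rising_add, add_comm, rising_add,
    (commute_rising_add_rising P n m).eq]

end Semiring

theorem rising_neg [Ring R] (P : R) (n : ℕ) :
    rising (-P) n = (-1) ^ n * rising (P - n + 1) n := by
  rw [rising, Polynomial.ascPochhammer_smeval_neg_eq_descPochhammer,
    Polynomial.descPochhammer_smeval_eq_ascPochhammer, Units.smul_def, zsmul_eq_mul,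
    Int.cast_negOnePow_natCast, rising]

theorem rising_eq_aeval {K : Type*} [CommSemiring K] [Semiring R] [Algebra K R] (P : R) (n : ℕ) :
    rising P n = Polynomial.aeval P (ascPochhammer K n) := by
  rw [rising, ← ascPochhammer_map (algebraMap ℕ K), Polynomial.aeval_map_algebraMap,
    Polynomial.aeval_eq_smeval]

end Rising

section Pochhammer

variable {r : ℕ}

theorem natCast_smul_one (n : ℕ) : (n : ℂ) • (1 : Mat r) = n := by
  rw [Nat.cast_smul_eq_nsmul, nsmul_one]

theorem intCast_smul_one (k : ℤ) : (k : ℂ) • (1 : Mat r) = k := by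
  rw [Int.cast_smul_eq_zsmul, zsmul_one]

theorem commute_inv {A X : Mat r} (h : Commute A X) : Commute A⁻¹ X := by
  simpa only [Matrix.zpow_neg_one] using Matrix.Commute.zpow_left h (-1)

theorem poch_natCast (A : Mat r) (n : ℕ) : poch A n = rising A n :=
  (rising_eq_aeval A n).symm

theorem poch_neg_natCast (A : Mat r) (n : ℕ) : poch A (-n) = (rising (A - n) n)⁻¹ := by
  cases n with
  | zero => simp [poch_zero]
  | succ n =>
    change ((-1 : ℂ) ^ (n + 1)) • (Polynomial.aeval (1 - A) (ascPochhammer ℂ (n + 1)))⁻¹ = _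
    have shift : A - 1 - (n + 1 : ℕ) + 1 = A - (n + 1 : ℕ) := by abel
    rw [← rising_eq_aeval, ← neg_sub A 1, rising_neg, shift]
    have sign_inv : ((-1 : Mat r) ^ (n + 1))⁻¹ = (-1) ^ (n + 1) :=
      Matrix.inv_eq_left_inv (by rw [← pow_add, Even.neg_one_pow ⟨_, rfl⟩])
    rw [Matrix.mul_inv_rev, sign_inv]
    rcases (n + 1).even_or_odd with h | h <;> simp [h.neg_one_pow]

theorem commute_poch {P X : Mat r} (h : Commute P X) (k : ℤ) : Commute (poch P k) X := by
  obtain ⟨n, rfl | rfl⟩ := k.eq_nat_or_neg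
  · exact poch_natCast P n ▸ commute_rising h n
  · exact poch_neg_natCast P n ▸
      commute_inv (commute_rising (h.sub_left (Nat.cast_commute n X)) n)

theorem IntRegular.isUnit_add {P : Mat r} (hP : IntRegular P) (k : ℤ) : IsUnit (P + k) :=
  intCast_smul_one (r := r) k ▸ hP k

theorem IntRegular.isUnit_rising_add {P : Mat r} (hP : IntRegular P) (k : ℤ) (n : ℕ) :
    IsUnit (rising (P + k) n) :=
  isUnit_rising (fun i => by simpa [add_assoc] using hP.isUnit_add (k + i)) n

theorem rising_mul_poch_add {P : Mat r} {k : ℤ} (h : IntRegular P ∨ 0 ≤ k) (N : ℕ) :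
    rising P N * poch (P + (N : Mat r)) k = rising (P + (k : Mat r)) N * poch P k := by
  obtain ⟨n, rfl | rfl⟩ := k.eq_nat_or_neg
  · rw [poch_natCast, poch_natCast, Int.cast_natCast, ← rising_add_mul_rising,
      (commute_rising_add_rising P N n).eq]
  · rcases h with hP | hn
    · have shift : P + ((-n : ℤ) : Mat r) = P - n := by push_cast; rw [sub_eq_add_neg]
      have hU : IsUnit (rising (P - n) n).det :=
        (Matrix.isUnit_iff_isUnit_det _).1 (shift ▸ hP.isUnit_rising_add (-n) n)
      have hV : IsUnit (rising (P + N - n) n).det := by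
        have := hP.isUnit_rising_add (N - n) n
        push_cast at this
        exact (Matrix.isUnit_iff_isUnit_det _).1 (add_sub_assoc P (N : Mat r) n ▸ this)
      have exchange : rising P N * rising (P - n) n = rising (P + N - n) n * rising (P - n) N := by
        simpa only [sub_add_cancel, sub_add_eq_add_sub] using rising_add_mul_rising (P - n) n N
      have comm : Commute (rising P N) (poch (P + (N : Mat r)) (-n)) :=
        commute_rising (commute_poch
          ((Commute.refl P).add_left (Nat.cast_commute N P)) (-n)).symm N
      calc rising P N * poch (P + (N : Mat r)) (-n)
          = (rising (P + N - n) n)⁻¹ * (rising P N * rising (P - n) n) * (rising (P - n) n)⁻¹ := by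
            rw [comm.eq, poch_neg_natCast, ← mul_assoc, Matrix.mul_nonsing_inv_cancel_right _ _ hU]
        _ = rising (P + ((-n : ℤ) : Mat r)) N * poch P (-n) := by
            rw [exchange, Matrix.nonsing_inv_mul_cancel_left _ _ hV, shift, poch_neg_natCast]
    · obtain rfl : n = 0 := by omega
      simp [poch_zero]

theorem rising_transpose (P : Mat r) (n : ℕ) : rising Pᵀ n = (rising P n)ᵀ := by
  induction n with
  | zero => simp
  | succ n ih =>
    have comm : Commute (rising P n) (P + n) :=
      commute_rising ((Commute.refl P).add_right (Nat.commute_cast P n)) n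
    rw [rising_succ, rising_succ, comm.eq, Matrix.transpose_mul, ih, Matrix.transpose_add,
      Matrix.transpose_natCast]

end Pochhammer

section BinomialSeries

variable {𝔸 : Type*} [NormedRing 𝔸] [NormedAlgebra ℂ 𝔸]

/-- The `n`-th term `(P)_n tⁿ / n!` of the binomial series of `(1 - t)^{-P}`. -/
noncomputable def binomialTerm (t : ℂ) (P : 𝔸) (n : ℕ) : 𝔸 := (t ^ n / (n ! : ℂ)) • rising P n

@[simp]
theorem binomialTerm_zero (t : ℂ) (P : 𝔸) : binomialTerm t P 0 = 1 := by
  simp [binomialTerm]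

theorem binomialTerm_succ (t : ℂ) (P : 𝔸) (n : ℕ) :
    binomialTerm t P (n + 1) = (t / (n + 1)) • (binomialTerm t P n * (P + n)) := by
  rw [binomialTerm, binomialTerm, rising_succ, smul_mul_assoc, smul_smul, Nat.factorial_succ]
  congr 1
  push_cast
  field_simp
  ring

theorem binomialTerm_add_one_succ (t : ℂ) (P : 𝔸) (n : ℕ) :
    binomialTerm t (P + 1) (n + 1) =
      binomialTerm t P (n + 1) + t • binomialTerm t (P + 1) n := by
  rw [binomialTerm, rising_add_one_succ, smul_add, ← Nat.cast_smul_eq_nsmul ℂ, smul_smul]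
  simp only [binomialTerm, smul_smul]
  congr 2
  rw [Nat.factorial_succ]
  push_cast
  field_simp
  ring

theorem norm_binomialTerm_succ_le (t : ℂ) (P : 𝔸) (n : ℕ) :
    ‖binomialTerm t P (n + 1)‖ ≤ ‖t‖ * (‖P‖ + n) / (n + 1) * ‖binomialTerm t P n‖ := by
  have factor : ‖binomialTerm t P n * (P + n)‖ ≤ ‖binomialTerm t P n‖ * (‖P‖ + n) := by
    rw [mul_add, mul_add, ← Nat.cast_comm, ← nsmul_eq_mul, mul_comm ‖binomialTerm t P n‖ (n : ℝ)]
    exact norm_add_le_of_le (norm_mul_le _ _) norm_nsmul_le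
  calc ‖binomialTerm t P (n + 1)‖
      = ‖t‖ / (n + 1) * ‖binomialTerm t P n * (P + n)‖ := by
        rw [binomialTerm_succ, norm_smul, norm_div]
        norm_cast
    _ ≤ ‖t‖ / (n + 1) * (‖binomialTerm t P n‖ * (‖P‖ + n)) := by gcongr
    _ = ‖t‖ * (‖P‖ + n) / (n + 1) * ‖binomialTerm t P n‖ := by ring

theorem summable_norm_binomialTerm (P : 𝔸) {t : ℂ} (ht : ‖t‖ < 1) :
    Summable fun n => ‖binomialTerm t P n‖ := by
  obtain ⟨ρ, hρ, hρ1⟩ := exists_between ht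
  refine summable_of_ratio_norm_eventually_le hρ1 ?_
  have large : ∀ᶠ n : ℕ in Filter.atTop, ‖t‖ * ‖P‖ / (ρ - ‖t‖) ≤ n :=
    tendsto_natCast_atTop_atTop.eventually_ge_atTop _
  filter_upwards [large] with n hn
  rw [div_le_iff₀ (sub_pos.2 hρ)] at hn
  rw [norm_norm, norm_norm]
  refine (norm_binomialTerm_succ_le t P n).trans ?_
  gcongr
  rw [div_le_iff₀ (by positivity)]
  linarith [norm_nonneg t]

theorem tsum_le_tsum_add_mul_tsum {u v w : ℕ → ℝ} {τ : ℝ} (hu : Summable u) (hv : Summable v)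
    (hw : Summable w) (zero : u 0 ≤ v 0) (succ : ∀ n, u (n + 1) ≤ v (n + 1) + τ * w n) :
    ∑' n, u n ≤ ∑' n, v n + τ * ∑' n, w n := by
  have hv' := (summable_nat_add_iff 1).2 hv
  have tail : ∑' n, u (n + 1) ≤ ∑' n, v (n + 1) + τ * ∑' n, w n := by
    rw [← tsum_mul_left, ← hv'.tsum_add (hw.mul_left τ)]
    exact ((summable_nat_add_iff 1).2 hu).tsum_le_tsum succ (hv'.add (hw.mul_left τ))
  rw [hu.tsum_eq_zero_add, hv.tsum_eq_zero_add]
  linarith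

theorem tsum_norm_binomialTerm_le_add_one (P : 𝔸) {t : ℂ} (ht : ‖t‖ < 1) :
    ∑' n, ‖binomialTerm t P n‖ ≤ (1 + ‖t‖) * ∑' n, ‖binomialTerm t (P + 1) n‖ := by
  have hs := summable_norm_binomialTerm (P + 1) ht
  rw [add_mul, one_mul]
  refine tsum_le_tsum_add_mul_tsum (summable_norm_binomialTerm P ht) hs hs (by simp) fun n => ?_
  rw [← norm_smul, eq_sub_of_add_eq (binomialTerm_add_one_succ t P n).symm]
  exact norm_sub_le _ _

theorem tsum_norm_binomialTerm_add_one_le (P : 𝔸) {t : ℂ} (ht : ‖t‖ < 1) :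
    (1 - ‖t‖) * ∑' n, ‖binomialTerm t (P + 1) n‖ ≤ ∑' n, ‖binomialTerm t P n‖ := by
  have hs := summable_norm_binomialTerm (P + 1) ht
  rw [sub_mul, one_mul, sub_le_iff_le_add]
  refine tsum_le_tsum_add_mul_tsum hs (summable_norm_binomialTerm P ht) hs (by simp) fun n => ?_
  rw [← norm_smul, binomialTerm_add_one_succ]
  exact norm_add_le _ _

theorem tsum_norm_binomialTerm_sub_natCast_le (P : 𝔸) {t : ℂ} (ht : ‖t‖ < 1) (k : ℕ) :
    ∑' n, ‖binomialTerm t (P - k) n‖ ≤ (1 + ‖t‖) ^ k * ∑' n, ‖binomialTerm t P n‖ := by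
  induction k with
  | zero => simp
  | succ k ih =>
    have shift : P - (k + 1 : ℕ) + 1 = P - k := by push_cast; abel
    calc ∑' n, ‖binomialTerm t (P - (k + 1 : ℕ)) n‖
        ≤ (1 + ‖t‖) * ∑' n, ‖binomialTerm t (P - k) n‖ :=
          shift ▸ tsum_norm_binomialTerm_le_add_one (P - (k + 1 : ℕ)) ht
      _ ≤ (1 + ‖t‖) * ((1 + ‖t‖) ^ k * ∑' n, ‖binomialTerm t P n‖) := by gcongr
      _ = (1 + ‖t‖) ^ (k + 1) * ∑' n, ‖binomialTerm t P n‖ := by ring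

theorem tsum_norm_binomialTerm_add_natCast_le (P : 𝔸) {t : ℂ} (ht : ‖t‖ < 1) (k : ℕ) :
    (1 - ‖t‖) ^ k * ∑' n, ‖binomialTerm t (P + k) n‖ ≤ ∑' n, ‖binomialTerm t P n‖ := by
  have : 0 < 1 - ‖t‖ := sub_pos.2 ht
  induction k with
  | zero => simp
  | succ k ih =>
    calc (1 - ‖t‖) ^ (k + 1) * ∑' n, ‖binomialTerm t (P + (k + 1 : ℕ)) n‖
        = (1 - ‖t‖) ^ k * ((1 - ‖t‖) * ∑' n, ‖binomialTerm t (P + k + 1) n‖) := by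
          rw [Nat.cast_succ, add_assoc, pow_succ, mul_assoc]
      _ ≤ (1 - ‖t‖) ^ k * ∑' n, ‖binomialTerm t (P + k) n‖ := by
          gcongr
          exact tsum_norm_binomialTerm_add_one_le (P + k) ht
      _ ≤ ∑' n, ‖binomialTerm t P n‖ := ih

theorem tsum_norm_binomialTerm_sub_intCast_le (P : 𝔸) {t : ℂ} (ht : ‖t‖ < 1) (k : ℤ) :
    ∑' n, ‖binomialTerm t (P - k) n‖ ≤
      ((1 - ‖t‖) ^ k + (1 + ‖t‖) ^ k) * ∑' n, ‖binomialTerm t P n‖ := by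
  have : 0 < 1 - ‖t‖ := sub_pos.2 ht
  have : 0 ≤ ∑' n, ‖binomialTerm t P n‖ := tsum_nonneg fun _ => norm_nonneg _
  rw [add_mul]
  obtain ⟨n, rfl | rfl⟩ := k.eq_nat_or_neg
  · rw [Int.cast_natCast, zpow_natCast, zpow_natCast]
    exact (tsum_norm_binomialTerm_sub_natCast_le P ht n).trans
      (le_add_of_nonneg_left (by positivity))
  · rw [Int.cast_neg, Int.cast_natCast, sub_neg_eq_add, zpow_neg, zpow_natCast, inv_mul_eq_div]
    refine le_add_of_le_of_nonneg ((le_div_iff₀' (by positivity)).2 ?_) (by positivity)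
    exact tsum_norm_binomialTerm_add_natCast_le P ht n

theorem norm_zpow_one_sub_le {t : ℂ} (ht : ‖t‖ < 1) (k : ℤ) :
    ‖(1 - t) ^ k‖ ≤ (1 - ‖t‖) ^ k + (1 + ‖t‖) ^ k := by
  have lower : 1 - ‖t‖ ≤ ‖1 - t‖ := by simpa using norm_sub_norm_le 1 t
  have upper : ‖1 - t‖ ≤ 1 + ‖t‖ := by simpa using norm_sub_le 1 t
  have hτ : 0 < 1 - ‖t‖ := sub_pos.2 ht
  have hq : 0 < ‖1 - t‖ := hτ.trans_le lower
  rw [norm_zpow]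
  obtain ⟨n, rfl | rfl⟩ := k.eq_nat_or_neg
  · simp only [zpow_natCast]
    exact le_add_of_nonneg_of_le (by positivity) (pow_le_pow_left₀ hq.le upper n)
  · simp only [zpow_neg, zpow_natCast]
    exact le_add_of_le_of_nonneg (inv_anti₀ (by positivity) (pow_le_pow_left₀ hτ.le lower n))
      (by positivity)

variable [CompleteSpace 𝔸]

theorem exp_neg_log_smul_sub_intCast (P : 𝔸) {t : ℂ} (ht : t ≠ 1) (k : ℤ) :
    NormedSpace.exp ((-Complex.log (1 - t)) • (P - k)) =
      (1 - t) ^ k • NormedSpace.exp ((-Complex.log (1 - t)) • P) := by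
  let +nondep : NormedAlgebra ℚ 𝔸 := .restrictScalars ℚ ℂ 𝔸
  have split : (-Complex.log (1 - t)) • (P - k) =
      algebraMap ℂ 𝔸 (k * Complex.log (1 - t)) + (-Complex.log (1 - t)) • P := by
    rw [smul_sub, neg_smul _ (k : 𝔸), sub_neg_eq_add, add_comm, Algebra.algebraMap_eq_smul_one,
      mul_comm, mul_smul, Int.cast_smul_eq_zsmul, zsmul_one]
  rw [split, NormedSpace.exp_add_of_commute (Algebra.commute_algebraMap_left _ _),
    ← NormedSpace.algebraMap_exp_comm, ← Algebra.smul_def, ← Complex.exp_eq_exp_ℂ,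
    Complex.exp_int_mul, Complex.exp_log (sub_ne_zero.2 ht.symm)]

theorem hasDerivAt_exp_neg_log_smul (P : 𝔸) {t : ℂ} (ht : ‖t‖ < 1) :
    HasDerivAt (fun s : ℂ => NormedSpace.exp ((-Complex.log (1 - s)) • P))
      (P * NormedSpace.exp ((-Complex.log (1 - t)) • (P + 1))) t := by
  have slit : 1 - t ∈ Complex.slitPlane := by
    simpa [sub_eq_add_neg] using Complex.mem_slitPlane_of_norm_lt_one (z := -t) (by simpa using ht)
  have ht1 : t ≠ 1 := fun h => by simp [h] at ht
  have shift : NormedSpace.exp ((-Complex.log (1 - t)) • (P + 1)) =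
      (1 - t)⁻¹ • NormedSpace.exp ((-Complex.log (1 - t)) • P) := by
    simpa using exp_neg_log_smul_sub_intCast P ht1 (-1)
  have log_deriv : HasDerivAt (fun s : ℂ => -Complex.log (1 - s)) (1 - t)⁻¹ t :=
    (((hasDerivAt_id' t).const_sub 1).clog slit).neg.congr_deriv (by rw [neg_div, neg_neg, one_div])
  rw [shift, mul_smul_comm]
  exact (hasDerivAt_exp_smul_const' P (-Complex.log (1 - t))).scomp t log_deriv

theorem iteratedDeriv_exp_neg_log_smul (P : 𝔸) (n : ℕ) :
    Set.EqOn (iteratedDeriv n fun t : ℂ => NormedSpace.exp ((-Complex.log (1 - t)) • P))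
      (fun t => rising P n * NormedSpace.exp ((-Complex.log (1 - t)) • (P + n)))
      (Metric.ball 0 1) := by
  induction n with
  | zero => intro t _; simp
  | succ n ih =>
    intro t ht
    rw [iteratedDeriv_succ, (ih.eventuallyEq_of_mem (Metric.isOpen_ball.mem_nhds ht)).deriv_eq,
      ((hasDerivAt_exp_neg_log_smul (P + n) (by simpa using ht)).const_mul (rising P n)).deriv,
      ← mul_assoc, ← rising_succ, add_assoc, ← Nat.cast_succ]

theorem hasSum_binomialTerm (P : 𝔸) {t : ℂ} (ht : ‖t‖ < 1) :
    HasSum (binomialTerm t P) (NormedSpace.exp ((-Complex.log (1 - t)) • P)) := by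
  have diff : DifferentiableOn ℂ (fun s : ℂ => NormedSpace.exp ((-Complex.log (1 - s)) • P))
      (Metric.ball 0 1) := fun z hz =>
    (hasDerivAt_exp_neg_log_smul P (by simpa using hz)).differentiableAt.differentiableWithinAt
  refine (Complex.hasSum_taylorSeries_on_ball diff (by simpa using ht)).congr_fun fun n => ?_
  rw [iteratedDeriv_exp_neg_log_smul P n (by simp), binomialTerm, smul_smul]
  simp [div_eq_inv_mul]

end BinomialSeries

section Interchange

variable {𝔸 ι : Type*} [NormedRing 𝔸] [NormedAlgebra ℂ 𝔸] {t : ℂ} {k : ι → ℤ} {f : ι → 𝔸}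

theorem summable_norm_binomialTerm_sub_mul (P : 𝔸) (ht : ‖t‖ < 1)
    (hsub : Summable fun i => (1 - ‖t‖) ^ k i * ‖f i‖)
    (hadd : Summable fun i => (1 + ‖t‖) ^ k i * ‖f i‖) :
    Summable fun z : ι × ℕ => ‖binomialTerm t (P - k z.1) z.2 * f z.1‖ := by
  have fiber (i : ι) : Summable fun n => ‖binomialTerm t (P - k i) n‖ * ‖f i‖ :=
    (summable_norm_binomialTerm (P - k i) ht).mul_right ‖f i‖
  have outer : Summable fun i => ∑' n, ‖binomialTerm t (P - k i) n‖ * ‖f i‖ := by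
    refine .of_nonneg_of_le (fun i => tsum_nonneg fun n => by positivity) (fun i => ?_)
      ((hsub.add hadd).mul_right (∑' n, ‖binomialTerm t P n‖))
    calc ∑' n, ‖binomialTerm t (P - k i) n‖ * ‖f i‖
        = (∑' n, ‖binomialTerm t (P - k i) n‖) * ‖f i‖ := tsum_mul_right
      _ ≤ ((1 - ‖t‖) ^ k i + (1 + ‖t‖) ^ k i) * (∑' n, ‖binomialTerm t P n‖) * ‖f i‖ := by
          gcongr
          exact tsum_norm_binomialTerm_sub_intCast_le P ht (k i)
      _ = _ := by ring
  have product : Summable fun z : ι × ℕ => ‖binomialTerm t (P - k z.1) z.2‖ * ‖f z.1‖ :=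
    (summable_prod_of_nonneg fun z => by positivity).2 ⟨fiber, outer⟩
  exact product.of_nonneg_of_le (fun z => norm_nonneg _) fun z => norm_mul_le _ _

variable [CompleteSpace 𝔸]

theorem summable_zpow_one_sub_smul (ht : ‖t‖ < 1)
    (hsub : Summable fun i => (1 - ‖t‖) ^ k i * ‖f i‖)
    (hadd : Summable fun i => (1 + ‖t‖) ^ k i * ‖f i‖) :
    Summable fun i => (1 - t) ^ k i • f i := by
  refine .of_norm_bounded (hsub.add hadd) fun i => ?_
  rw [norm_smul, ← add_mul]
  gcongr
  exact norm_zpow_one_sub_le ht (k i)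

theorem hasSum_tsum_binomialTerm_sub_mul (P : 𝔸) (ht : ‖t‖ < 1)
    (hsub : Summable fun i => (1 - ‖t‖) ^ k i * ‖f i‖)
    (hadd : Summable fun i => (1 + ‖t‖) ^ k i * ‖f i‖) :
    HasSum (fun n => ∑' i, binomialTerm t (P - k i) n * f i)
      (NormedSpace.exp ((-Complex.log (1 - t)) • P) * ∑' i, (1 - t) ^ k i • f i) := by
  have joint := (summable_norm_binomialTerm_sub_mul P ht hsub hadd).of_norm
  have ht1 : t ≠ 1 := fun h => by simp [h] at ht
  have row (i : ι) : ∑' n, binomialTerm t (P - k i) n * f i =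
      NormedSpace.exp ((-Complex.log (1 - t)) • P) * (1 - t) ^ k i • f i := by
    rw [((hasSum_binomialTerm (P - k i) ht).mul_right (f i)).tsum_eq,
      exp_neg_log_smul_sub_intCast P ht1, smul_mul_assoc, mul_smul_comm]
  have total : ∑' n, ∑' i, binomialTerm t (P - k i) n * f i =
      NormedSpace.exp ((-Complex.log (1 - t)) • P) * ∑' i, (1 - t) ^ k i • f i :=
    calc ∑' n, ∑' i, binomialTerm t (P - k i) n * f i
        = ∑' i, ∑' n, binomialTerm t (P - k i) n * f i := joint.tsum_comm
      _ = ∑' i, NormedSpace.exp ((-Complex.log (1 - t)) • P) * (1 - t) ^ k i • f i :=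
          tsum_congr row
      _ = _ := (summable_zpow_one_sub_smul ht hsub hadd).tsum_mul_left _
  exact total ▸ joint.prod_symm.prod.hasSum

theorem summable_binomialTerm_sub_mul (P : 𝔸) (ht : ‖t‖ < 1)
    (hsub : Summable fun i => (1 - ‖t‖) ^ k i * ‖f i‖)
    (hadd : Summable fun i => (1 + ‖t‖) ^ k i * ‖f i‖) (n : ℕ) :
    Summable fun i => binomialTerm t (P - k i) n * f i :=
  (summable_norm_binomialTerm_sub_mul P ht hsub hadd).of_norm.prod_symm.prod_factor n

end Interchange

section DoubleSeries

attribute [local instance] Matrix.linftyOpNormedRing Matrix.linftyOpNormedAlgebra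

variable {r : ℕ} {c : DoubleSeries r} {x y : ℂ}

/-- The `(m, n)`-th term `x^m y^n / (m! n!) • c m n` of a double power series at `(x, y)`. -/
noncomputable def DoubleSeries.term (c : DoubleSeries r) (x y : ℂ) (p : ℕ × ℕ) : Mat r :=
  (x ^ p.1 * y ^ p.2 / ((p.1 ! : ℂ) * (p.2 ! : ℂ))) • c p.1 p.2

/-- The double power series whose coefficients are the transposes of those of `c`; it exchanges
left and right multiplication. -/
def DoubleSeries.transpose (c : DoubleSeries r) : DoubleSeries r := fun m n => (c m n)ᵀ

theorem eval_eq_tsum_term (c : DoubleSeries r) (x y : ℂ) : c.eval x y = ∑' p, c.term x y p := rfl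

theorem norm_term (c : DoubleSeries r) (x y : ℂ) (p : ℕ × ℕ) :
    ‖c.term x y p‖ = ‖x‖ ^ p.1 * ‖y‖ ^ p.2 / ((p.1 ! : ℝ) * (p.2 ! : ℝ)) * ‖c p.1 p.2‖ := by
  simp [DoubleSeries.term, norm_smul]

theorem term_mul_zpow (c : DoubleSeries r) (x y : ℂ) {q : ℂ} (hq : q ≠ 0) (a b : ℤ) (p : ℕ × ℕ) :
    c.term (x * q ^ a) (y * q ^ b) p = q ^ (a * p.1 + b * p.2) • c.term x y p := by
  rw [DoubleSeries.term, DoubleSeries.term, smul_smul, zpow_add₀ hq, zpow_mul, zpow_mul,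
    zpow_natCast, zpow_natCast]
  congr 1
  ring

theorem mem_domain_iff : (x, y) ∈ c.domain ↔
    ∃ R S : ℝ, ‖x‖ < R ∧ ‖y‖ < S ∧ Summable (c.term (R : ℂ) (S : ℂ)) := by
  refine exists₂_congr fun R S => and_congr_right fun hR => and_congr_right fun hS => ?_
  have hR0 : 0 ≤ R := (norm_nonneg x).trans hR.le
  have hS0 : 0 ≤ S := (norm_nonneg y).trans hS.le
  have entries : Summable (c.term (R : ℂ) (S : ℂ)) ↔
      ∀ i j, Summable fun p => c.term (R : ℂ) (S : ℂ) p i j :=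
    Pi.summable.trans (forall_congr' fun i => Pi.summable)
  rw [entries]
  refine forall₂_congr fun i j => ?_
  rw [← summable_norm_iff (f := fun p => c.term (R : ℂ) (S : ℂ) p i j)]
  simp [DoubleSeries.term, abs_of_nonneg hR0, abs_of_nonneg hS0]

theorem summable_norm_term_of_mem_domain (h : (x, y) ∈ c.domain) :
    Summable fun p => ‖c.term x y p‖ := by
  obtain ⟨R, S, hR, hS, hs⟩ := mem_domain_iff.1 h
  refine hs.norm.of_nonneg_of_le (fun p => norm_nonneg _) fun p => ?_
  rw [norm_term, norm_term]
  gcongr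
  · exact hR.le.trans (RCLike.norm_ofReal (K := ℂ) R ▸ le_abs_self R)
  · exact hS.le.trans (RCLike.norm_ofReal (K := ℂ) S ▸ le_abs_self S)

theorem summable_term_of_mem_domain (h : (x, y) ∈ c.domain) : Summable (c.term x y) :=
  have : CompleteSpace (Mat r) := FiniteDimensional.complete ℂ (Mat r)
  (summable_norm_term_of_mem_domain h).of_norm

theorem isOpen_domain (c : DoubleSeries r) : IsOpen c.domain := by
  refine isOpen_iff_mem_nhds.2 fun z ⟨R, S, hR, hS, hs⟩ => ?_
  filter_upwards [continuous_fst.norm.continuousAt.eventually_lt_const hR,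
    continuous_snd.norm.continuousAt.eventually_lt_const hS] with w hwR hwS
  exact ⟨R, S, hwR, hwS, hs⟩

theorem exists_norm_lt_mem_domain (h : (x, y) ∈ c.domain) :
    ∃ R S : ℝ, ‖x‖ < R ∧ ‖y‖ < S ∧ ((R : ℂ), (S : ℂ)) ∈ c.domain := by
  obtain ⟨R, S, hR, hS, hs⟩ := h
  obtain ⟨R', hxR', hR'⟩ := exists_between hR
  obtain ⟨S', hyS', hS'⟩ := exists_between hS
  refine ⟨R', S', hxR', hyS', R, S, ?_, ?_, hs⟩
  · rwa [Complex.norm_of_nonneg ((norm_nonneg _).trans hxR'.le)]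
  · rwa [Complex.norm_of_nonneg ((norm_nonneg _).trans hyS'.le)]

theorem exists_closedBall_rescaled_mem_domain (h : (x, y) ∈ c.domain) (a b : ℤ) :
    ∃ t : ℂ, t ≠ 0 ∧ ‖t‖ < 1 ∧
      ∀ s : ℂ, ‖s‖ ≤ ‖t‖ → (x * (1 - s) ^ a, y * (1 - s) ^ b) ∈ c.domain := by
  have cont : ContinuousAt (fun s : ℂ => (x * (1 - s) ^ a, y * (1 - s) ^ b)) 0 := by
    refine .prodMk (continuousAt_const.mul ?_) (continuousAt_const.mul ?_) <;>
      exact (by fun_prop : ContinuousAt (fun s : ℂ => 1 - s) 0).zpow₀ _ (.inl (by simp))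
  have near : ∀ᶠ s : ℂ in nhds 0, (x * (1 - s) ^ a, y * (1 - s) ^ b) ∈ c.domain :=
    cont.eventually_mem ((isOpen_domain c).mem_nhds (by simpa using h))
  obtain ⟨ε, hε, hmem⟩ := Metric.eventually_nhds_iff.1 near
  obtain ⟨τ, hτ, hτε⟩ := exists_between (lt_min hε one_pos)
  have norm_τ : ‖(τ : ℂ)‖ = τ := Complex.norm_of_nonneg hτ.le
  refine ⟨τ, by exact_mod_cast hτ.ne', norm_τ.trans_lt (hτε.trans_le (min_le_right _ _)),
    fun s hs => hmem ?_⟩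
  rw [dist_zero_right]
  exact (hs.trans_eq norm_τ).trans_lt (hτε.trans_le (min_le_left _ _))

theorem summable_zpow_mul_norm_term {q : ℝ} (hq : 0 < q) {a b : ℤ}
    (h : (x * (q : ℂ) ^ a, y * (q : ℂ) ^ b) ∈ c.domain) :
    Summable fun p : ℕ × ℕ => q ^ (a * p.1 + b * p.2) * ‖c.term x y p‖ := by
  refine (summable_norm_term_of_mem_domain h).congr fun p => ?_
  rw [term_mul_zpow c x y (by exact_mod_cast hq.ne'), norm_smul, norm_zpow,
    Complex.norm_of_nonneg hq.le]

theorem summable_sub_zpow_mul_norm_term {t : ℂ} (ht : ‖t‖ < 1) {a b : ℤ}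
    (h : ∀ s : ℂ, ‖s‖ ≤ ‖t‖ → (x * (1 - s) ^ a, y * (1 - s) ^ b) ∈ c.domain) :
    Summable fun p : ℕ × ℕ => (1 - ‖t‖) ^ (a * p.1 + b * p.2) * ‖c.term x y p‖ :=
  summable_zpow_mul_norm_term (sub_pos.2 ht) (by simpa using h ‖t‖ (by simp))

theorem summable_add_zpow_mul_norm_term {t : ℂ} {a b : ℤ}
    (h : ∀ s : ℂ, ‖s‖ ≤ ‖t‖ → (x * (1 - s) ^ a, y * (1 - s) ^ b) ∈ c.domain) :
    Summable fun p : ℕ × ℕ => (1 + ‖t‖) ^ (a * p.1 + b * p.2) * ‖c.term x y p‖ :=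
  summable_zpow_mul_norm_term (by positivity) (by simpa using h (-‖t‖) (by simp))

theorem term_transpose (c : DoubleSeries r) (x y : ℂ) (p : ℕ × ℕ) :
    c.transpose.term x y p = (c.term x y p)ᵀ :=
  (Matrix.transpose_smul _ _).symm

theorem eval_transpose (c : DoubleSeries r) (x y : ℂ) : c.transpose.eval x y = (c.eval x y)ᵀ := by
  simp only [eval_eq_tsum_term, term_transpose, Matrix.transpose_tsum]

theorem domain_transpose (c : DoubleSeries r) : c.transpose.domain = c.domain := by
  ext ⟨x, y⟩
  simp only [mem_domain_iff, funext (term_transpose c _ _), summable_matrix_transpose]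

end DoubleSeries

section Shift

variable {r : ℕ} {F : Mat r → DoubleSeries r} {P : Mat r} {a b : ℤ}

/-- The coefficients of `F (P + N)` and `F P` are related by
`(P)_N F(P + N)_{mn} = (P - (am + bn))_N F(P)_{mn}`. This is the contiguity relation behind the
summation formula with rescaling exponents `a`, `b` in which `(P)_N` multiplies from the left. -/
def LeftShift (F : Mat r → DoubleSeries r) (P : Mat r) (a b : ℤ) : Prop :=
  ∀ N m n : ℕ, rising P N * F (P + (N : Mat r)) m n =
    rising (P - ((a * m + b * n : ℤ) : Mat r)) N * F P m n

/-- The mirror image of `LeftShift`, in which the rising factorials multiply from the right. -/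
def RightShift (F : Mat r → DoubleSeries r) (P : Mat r) (a b : ℤ) : Prop :=
  ∀ N m n : ℕ, F (P + (N : Mat r)) m n * rising P N =
    F P m n * rising (P - ((a * m + b * n : ℤ) : Mat r)) N

section SummationFormula

attribute [local instance] Matrix.linftyOpNormedRing Matrix.linftyOpNormedAlgebra

theorem LeftShift.binomialTerm_mul_term (hF : LeftShift F P a b) (t x y : ℂ) (N : ℕ)
    (p : ℕ × ℕ) :
    binomialTerm t (P - ((a * p.1 + b * p.2 : ℤ) : Mat r)) N * (F P).term x y p =
      (t ^ N / (N ! : ℂ)) • (rising P N * (F (P + (N : Mat r))).term x y p) := by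
  rw [binomialTerm, smul_mul_assoc, DoubleSeries.term, DoubleSeries.term, mul_smul_comm,
    mul_smul_comm, hF N p.1 p.2]

theorem LeftShift.mem_domain (hF : LeftShift F P a b) {N : ℕ} (hN : IsUnit (rising P N)) {x y : ℂ}
    (h : (x, y) ∈ (F P).domain) : (x, y) ∈ (F (P + (N : Mat r))).domain := by
  have : CompleteSpace (Mat r) := FiniteDimensional.complete ℂ (Mat r)
  obtain ⟨R, S, hR, hS, hRS⟩ := exists_norm_lt_mem_domain h
  obtain ⟨t, ht0, ht, hdisc⟩ := exists_closedBall_rescaled_mem_domain hRS a b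
  have summable := summable_binomialTerm_sub_mul P ht (summable_sub_zpow_mul_norm_term ht hdisc)
    (summable_add_zpow_mul_norm_term hdisc) N
  simp only [hF.binomialTerm_mul_term] at summable
  have scalar_ne : t ^ N / (N ! : ℂ) ≠ 0 :=
    div_ne_zero (pow_ne_zero N ht0) (mod_cast N.factorial_ne_zero)
  obtain ⟨u, hu⟩ := hN
  refine mem_domain_iff.2 ⟨R, S, hR, hS, ?_⟩
  refine ((summable.const_smul (t ^ N / (N ! : ℂ))⁻¹).mul_left (↑u⁻¹ : Mat r)).congr fun p => ?_
  rw [inv_smul_smul₀ scalar_ne, ← hu, Units.inv_mul_cancel_left]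

theorem LeftShift.leftFormula (hF : LeftShift F P a b) : LeftFormula F P a b := by
  rintro x y t ⟨ht, hdisc, hsingular⟩
  have : CompleteSpace (Mat r) := FiniteDimensional.complete ℂ (Mat r)
  simp only [natCast_smul_one, poch_natCast] at hsingular ⊢
  have dom (N : ℕ) : (x, y) ∈ (F (P + (N : Mat r))).domain := by
    by_cases hN : IsUnit (rising P N)
    · exact hF.mem_domain hN (by simpa using hdisc 0 (by simp))
    · exact hsingular N hN
  refine ⟨dom, ?_⟩
  have interchange := hasSum_tsum_binomialTerm_sub_mul P ht
    (summable_sub_zpow_mul_norm_term ht hdisc) (summable_add_zpow_mul_norm_term hdisc)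
  have ht1 : 1 - t ≠ 0 := fun h => by simp [← sub_eq_zero.1 h] at ht
  simp only [hF.binomialTerm_mul_term, ← term_mul_zpow _ x y ht1] at interchange
  refine interchange.congr_fun fun N => ?_
  have summable := summable_term_of_mem_domain (dom N)
  calc (t ^ N / (N ! : ℂ)) • (rising P N * (F (P + (N : Mat r))).eval x y)
      = (t ^ N / (N ! : ℂ)) • ∑' p, rising P N * (F (P + (N : Mat r))).term x y p := by
        rw [eval_eq_tsum_term, summable.tsum_mul_left]
    _ = ∑' p, (t ^ N / (N ! : ℂ)) • (rising P N * (F (P + (N : Mat r))).term x y p) :=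
        ((summable.mul_left _).tsum_const_smul _).symm

end SummationFormula

theorem RightShift.transpose (hF : RightShift F P a b) :
    LeftShift (fun Q => (F Qᵀ).transpose) Pᵀ a b := by
  intro N m n
  have mirrored := congrArg Matrix.transpose (hF N m n)
  simpa only [Matrix.transpose_mul, ← rising_transpose, Matrix.transpose_sub,
    Matrix.transpose_intCast, DoubleSeries.transpose, Matrix.transpose_add,
    Matrix.transpose_natCast, Matrix.transpose_transpose] using mirrored

theorem rightFormula_of_transpose (h : LeftFormula (fun Q => (F Qᵀ).transpose) Pᵀ a b) :
    RightFormula F P a b := by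
  intro x y t hadm
  simp only [LeftFormula, Admissible, domain_transpose, eval_transpose, oneSubPowNeg,
    natCast_smul_one, poch_natCast, rising_transpose, Matrix.isUnit_transpose,
    Matrix.transpose_add, Matrix.transpose_natCast, Matrix.transpose_transpose,
    ← Matrix.transpose_mul, ← Matrix.transpose_smul, Matrix.exp_transpose] at h
  simp only [Admissible, natCast_smul_one, poch_natCast] at hadm
  obtain ⟨dom, hsum⟩ := h x y t hadm
  simp only [natCast_smul_one, poch_natCast]
  exact ⟨dom, by simpa only [Matrix.transpose_transpose, oneSubPowNeg] using hsum.matrix_transpose⟩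

theorem RightShift.rightFormula (hF : RightShift F P a b) : RightFormula F P a b :=
  rightFormula_of_transpose hF.transpose.leftFormula

end Shift

section ShiftRules

variable {r : ℕ} {F : Mat r → DoubleSeries r} {E : ℕ → ℕ → Mat r} {P : Mat r} {a b : ℤ}
  {k : ℕ → ℕ → ℤ}

theorem commute_rising_sub_intCast {X : Mat r} (h : Commute P X) (j : ℤ) (N : ℕ) :
    Commute (rising (P - (j : Mat r)) N) X :=
  commute_rising (h.sub_left (Int.cast_commute j X)) N

theorem LeftShift.mul_right (hF : LeftShift F P a b) :
    LeftShift (fun Q m n => F Q m n * E m n) P a b := fun N m n => by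
  rw [← mul_assoc, hF N m n, mul_assoc]

theorem LeftShift.mul_left (hE : ∀ m n, Commute (E m n) P) (hF : LeftShift F P a b) :
    LeftShift (fun Q m n => E m n * F Q m n) P a b := fun N m n => by
  rw [(commute_rising (hE m n).symm N).left_comm, hF N m n,
    (commute_rising_sub_intCast (hE m n).symm _ N).left_comm]

theorem RightShift.mul_left (hF : RightShift F P a b) :
    RightShift (fun Q m n => E m n * F Q m n) P a b := fun N m n => by
  rw [mul_assoc, hF N m n, ← mul_assoc]

theorem RightShift.mul_right (hE : ∀ m n, Commute (E m n) P) (hF : RightShift F P a b) :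
    RightShift (fun Q m n => F Q m n * E m n) P a b := fun N m n => by
  rw [mul_assoc, ← (commute_rising (hE m n).symm N).eq, ← mul_assoc, hF N m n, mul_assoc,
    (commute_rising_sub_intCast (hE m n).symm _ N).eq, mul_assoc]

theorem LeftShift.poch_of_intRegular_or_nonneg (h : ∀ m n, IntRegular P ∨ 0 ≤ k m n)
    (hk : ∀ m n, a * m + b * n = -k m n) :
    LeftShift (fun Q m n => poch Q (k m n)) P a b := fun N m n => by
  rw [hk, Int.cast_neg, sub_neg_eq_add]
  exact rising_mul_poch_add (h m n) N

theorem RightShift.poch_of_intRegular_or_nonneg (h : ∀ m n, IntRegular P ∨ 0 ≤ k m n)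
    (hk : ∀ m n, a * m + b * n = -k m n) :
    RightShift (fun Q m n => poch Q (k m n)) P a b := fun N m n => by
  have comm_add : Commute (P + (N : Mat r)) (rising P N) :=
    (commute_rising ((Commute.refl P).add_right (Nat.commute_cast P N)) N).symm
  have comm_sub := commute_poch (commute_rising_sub_intCast (Commute.refl P) (a * m + b * n) N).symm
  rw [(commute_poch comm_add _).eq, LeftShift.poch_of_intRegular_or_nonneg h hk N m n,
    (comm_sub _).eq]

theorem LeftShift.poch_of_intRegular (h : IntRegular P)
    (hk : ∀ m n, a * m + b * n = -k m n := by intros; ring) :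
    LeftShift (fun Q m n => poch Q (k m n)) P a b :=
  .poch_of_intRegular_or_nonneg (fun _ _ => .inl h) hk

theorem LeftShift.poch_of_nonneg (h : ∀ m n, 0 ≤ k m n := by intros; positivity)
    (hk : ∀ m n, a * m + b * n = -k m n := by intros; ring) :
    LeftShift (fun Q m n => poch Q (k m n)) P a b :=
  .poch_of_intRegular_or_nonneg (fun m n => .inr (h m n)) hk

theorem RightShift.poch_of_intRegular (h : IntRegular P)
    (hk : ∀ m n, a * m + b * n = -k m n := by intros; ring) :
    RightShift (fun Q m n => poch Q (k m n)) P a b :=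
  .poch_of_intRegular_or_nonneg (fun _ _ => .inl h) hk

theorem RightShift.poch_of_nonneg (h : ∀ m n, 0 ≤ k m n := by intros; positivity)
    (hk : ∀ m n, a * m + b * n = -k m n := by intros; ring) :
    RightShift (fun Q m n => poch Q (k m n)) P a b :=
  .poch_of_intRegular_or_nonneg (fun m n => .inr (h m n)) hk

end ShiftRules

section SummationFormulas

variable {r : ℕ} {A A' B B' C C' C'' : Mat r}

theorem leftFormula_G2_A : LeftFormula (fun P => G2 P A' B B') A (-1) 0 :=
  LeftShift.leftFormula <| .mul_right <| .mul_right <| .mul_right <| .poch_of_nonneg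

theorem leftFormula_G2_A' (hAA' : Commute A A') : LeftFormula (fun P => G2 A P B B') A' 0 (-1) :=
  LeftShift.leftFormula <| .mul_right <| .mul_right <|
    .mul_left (fun _ _ => commute_poch hAA' _) <| .poch_of_nonneg

theorem rightFormula_G2_B (hB : IntRegular B) (hBB' : Commute B B') :
    RightFormula (fun P => G2 A A' P B') B 1 (-1) :=
  RightShift.rightFormula <| .mul_right (fun _ _ => commute_poch hBB'.symm _) <| .mul_left <|
    .poch_of_intRegular hB

theorem rightFormula_G2_B' (hB' : IntRegular B') : RightFormula (fun P => G2 A A' B P) B' (-1) 1 :=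
  RightShift.rightFormula <| .mul_left <| .poch_of_intRegular hB'

theorem leftFormula_G3_A (hA : IntRegular A) : LeftFormula (fun P => G3 P A') A 1 (-2) :=
  LeftShift.leftFormula <| .mul_right <| .poch_of_intRegular hA

theorem rightFormula_G3_A' (hA' : IntRegular A') : RightFormula (fun P => G3 A P) A' (-2) 1 :=
  RightShift.rightFormula <| .mul_left <| .poch_of_intRegular hA'

theorem leftFormula_H1_A (hA : IntRegular A) : LeftFormula (fun P => H1 P B C C') A (-1) 1 :=
  LeftShift.leftFormula <| .mul_right <| .mul_right <| .mul_right <| .poch_of_intRegular hA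

theorem leftFormula_H1_B (hAB : Commute A B) : LeftFormula (fun P => H1 A P C C') B (-1) (-1) :=
  LeftShift.leftFormula <| .mul_right <| .mul_right <| .mul_left (fun _ _ => commute_poch hAB _) <|
    .poch_of_nonneg

theorem rightFormula_H1_C (hCC' : Commute C C') : RightFormula (fun P => H1 A B P C') C 0 (-1) :=
  RightShift.rightFormula <| .mul_right (fun _ _ => commute_inv (commute_poch hCC'.symm _)) <|
    .mul_left <| .poch_of_nonneg

theorem leftFormula_H2_A (hA : IntRegular A) : LeftFormula (fun P => H2 P B C C' C'') A (-1) 1 :=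
  LeftShift.leftFormula <| .mul_right <| .mul_right <| .mul_right <| .mul_right <|
    .poch_of_intRegular hA

theorem leftFormula_H2_B (hAB : Commute A B) : LeftFormula (fun P => H2 A P C C' C'') B (-1) 0 :=
  LeftShift.leftFormula <| .mul_right <| .mul_right <| .mul_right <|
    .mul_left (fun _ _ => commute_poch hAB _) <| .poch_of_nonneg

theorem rightFormula_H2_C (hCC' : Commute C C') (hCC'' : Commute C C'') :
    RightFormula (fun P => H2 A B P C' C'') C 0 (-1) :=
  RightShift.rightFormula <| .mul_right (fun _ _ => commute_inv (commute_poch hCC''.symm _)) <|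
    .mul_right (fun _ _ => commute_poch hCC'.symm _) <| .mul_left <| .poch_of_nonneg

theorem rightFormula_H2_C' (hC'C'' : Commute C' C'') :
    RightFormula (fun P => H2 A B C P C'') C' 0 (-1) :=
  RightShift.rightFormula <| .mul_right (fun _ _ => commute_inv (commute_poch hC'C''.symm _)) <|
    .mul_left <| .poch_of_nonneg

theorem leftFormula_H3_A : LeftFormula (fun P => H3 P B C) A (-2) (-1) :=
  LeftShift.leftFormula <| .mul_right <| .mul_right <| .poch_of_nonneg

theorem leftFormula_H3_B (hAB : Commute A B) : LeftFormula (fun P => H3 A P C) B 0 (-1) :=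
  LeftShift.leftFormula <| .mul_right <| .mul_left (fun _ _ => commute_poch hAB _) <|
    .poch_of_nonneg

theorem leftFormula_H4_A : LeftFormula (fun P => H4 P B C C') A (-2) (-1) :=
  LeftShift.leftFormula <| .mul_right <| .mul_right <| .mul_right <| .poch_of_nonneg

theorem leftFormula_H4_B (hAB : Commute A B) : LeftFormula (fun P => H4 A P C C') B 0 (-1) :=
  LeftShift.leftFormula <| .mul_right <| .mul_right <| .mul_left (fun _ _ => commute_poch hAB _) <|
    .poch_of_nonneg

theorem leftFormula_H5_A : LeftFormula (fun P => H5 P B C) A (-2) (-1) :=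
  LeftShift.leftFormula <| .mul_right <| .mul_right <| .poch_of_nonneg

theorem leftFormula_H5_B (hB : IntRegular B) (hAB : Commute A B) :
    LeftFormula (fun P => H5 A P C) B 1 (-1) :=
  LeftShift.leftFormula <| .mul_right <| .mul_left (fun _ _ => commute_poch hAB _) <|
    .poch_of_intRegular hB

theorem leftFormula_H6_A (hA : IntRegular A) : LeftFormula (fun P => H6 P B C) A (-2) 1 :=
  LeftShift.leftFormula <| .mul_right <| .mul_right <| .poch_of_intRegular hA

theorem leftFormula_H6_B (hB : IntRegular B) (hAB : Commute A B) :
    LeftFormula (fun P => H6 A P C) B 1 (-1) :=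
  LeftShift.leftFormula <| .mul_right <| .mul_left (fun _ _ => commute_poch hAB _) <|
    .poch_of_intRegular hB

theorem leftFormula_H7_A (hA : IntRegular A) : LeftFormula (fun P => H7 P B C C') A (-2) 1 :=
  LeftShift.leftFormula <| .mul_right <| .mul_right <| .mul_right <| .poch_of_intRegular hA

theorem leftFormula_H7_B (hAB : Commute A B) : LeftFormula (fun P => H7 A P C C') B 0 (-1) :=
  LeftShift.leftFormula <| .mul_right <| .mul_right <| .mul_left (fun _ _ => commute_poch hAB _) <|
    .poch_of_nonneg

theorem rightFormula_H7_C (hCC' : Commute C C') : RightFormula (fun P => H7 A B P C') C 0 (-1) :=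
  RightShift.rightFormula <| .mul_right (fun _ _ => commute_inv (commute_poch hCC'.symm _)) <|
    .mul_left <| .poch_of_nonneg

theorem leftFormula_Gamma1_A : LeftFormula (fun P => Gamma1 P B B') A (-1) 0 :=
  LeftShift.leftFormula <| .mul_right <| .mul_right <| .poch_of_nonneg

theorem rightFormula_Gamma1_B (hB : IntRegular B) (hBB' : Commute B B') :
    RightFormula (fun P => Gamma1 A P B') B 1 (-1) :=
  RightShift.rightFormula <| .mul_right (fun _ _ => commute_poch hBB'.symm _) <| .mul_left <|
    .poch_of_intRegular hB

theorem rightFormula_Gamma1_B' (hB' : IntRegular B') :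
    RightFormula (fun P => Gamma1 A B P) B' (-1) 1 :=
  RightShift.rightFormula <| .mul_left <| .poch_of_intRegular hB'

theorem leftFormula_Gamma2_B (hB : IntRegular B) : LeftFormula (fun P => Gamma2 P B') B 1 (-1) :=
  LeftShift.leftFormula <| .mul_right <| .poch_of_intRegular hB

theorem rightFormula_Gamma2_B' (hB' : IntRegular B') :
    RightFormula (fun P => Gamma2 B P) B' (-1) 1 :=
  RightShift.rightFormula <| .mul_left <| .poch_of_intRegular hB'

theorem leftFormula_calH1_A (hA : IntRegular A) : LeftFormula (fun P => calH1 P B C) A (-1) 1 :=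
  LeftShift.leftFormula <| .mul_right <| .mul_right <| .poch_of_intRegular hA

theorem leftFormula_calH1_B (hAB : Commute A B) : LeftFormula (fun P => calH1 A P C) B (-1) (-1) :=
  LeftShift.leftFormula <| .mul_right <| .mul_left (fun _ _ => commute_poch hAB _) <|
    .poch_of_nonneg

theorem leftFormula_calH2_A (hA : IntRegular A) : LeftFormula (fun P => calH2 P B B' C) A (-1) 1 :=
  LeftShift.leftFormula <| .mul_right <| .mul_right <| .mul_right <| .poch_of_intRegular hA

theorem leftFormula_calH2_B (hAB : Commute A B) : LeftFormula (fun P => calH2 A P B' C) B (-1) 0 :=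
  LeftShift.leftFormula <| .mul_right <| .mul_right <| .mul_left (fun _ _ => commute_poch hAB _) <|
    .poch_of_nonneg

theorem rightFormula_calH2_B' (hB'C : Commute B' C) :
    RightFormula (fun P => calH2 A B P C) B' 0 (-1) :=
  RightShift.rightFormula <| .mul_right (fun _ _ => commute_inv (commute_poch hB'C.symm _)) <|
    .mul_left <| .poch_of_nonneg

theorem leftFormula_calH3_A (hA : IntRegular A) : LeftFormula (fun P => calH3 P B C) A (-1) 1 :=
  LeftShift.leftFormula <| .mul_right <| .mul_right <| .poch_of_intRegular hA

theorem leftFormula_calH3_B (hAB : Commute A B) : LeftFormula (fun P => calH3 A P C) B (-1) 0 :=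
  LeftShift.leftFormula <| .mul_right <| .mul_left (fun _ _ => commute_poch hAB _) <|
    .poch_of_nonneg

theorem leftFormula_calH4_A (hA : IntRegular A) : LeftFormula (fun P => calH4 P B' C) A (-1) 1 :=
  LeftShift.leftFormula <| .mul_right <| .mul_right <| .poch_of_intRegular hA

theorem leftFormula_calH4_B' (hAB' : Commute A B') : LeftFormula (fun P => calH4 A P C) B' 0 (-1) :=
  LeftShift.leftFormula <| .mul_right <| .mul_left (fun _ _ => commute_poch hAB' _) <|
    .poch_of_nonneg

theorem leftFormula_calH5_A (hA : IntRegular A) : LeftFormula (fun P => calH5 P C) A (-1) 1 :=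
  LeftShift.leftFormula <| .mul_right <| .poch_of_intRegular hA

theorem leftFormula_calH6_A : LeftFormula (fun P => calH6 P C) A (-2) (-1) :=
  LeftShift.leftFormula <| .mul_right <| .poch_of_nonneg

theorem leftFormula_calH7_A : LeftFormula (fun P => calH7 P C C') A (-2) (-1) :=
  LeftShift.leftFormula <| .mul_right <| .mul_right <| .poch_of_nonneg

theorem leftFormula_calH8_A (hA : IntRegular A) : LeftFormula (fun P => calH8 P B) A (-2) 1 :=
  LeftShift.leftFormula <| .mul_right <| .poch_of_intRegular hA

theorem rightFormula_calH8_B (hB : IntRegular B) : RightFormula (fun P => calH8 A P) B 1 (-1) :=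
  RightShift.rightFormula <| .mul_left <| .poch_of_intRegular hB

theorem leftFormula_calH9_A (hA : IntRegular A) : LeftFormula (fun P => calH9 P B C) A (-2) 1 :=
  LeftShift.leftFormula <| .mul_right <| .mul_right <| .poch_of_intRegular hA

theorem leftFormula_calH9_B (hAB : Commute A B) : LeftFormula (fun P => calH9 A P C) B 0 (-1) :=
  LeftShift.leftFormula <| .mul_right <| .mul_left (fun _ _ => commute_poch hAB _) <|
    .poch_of_nonneg

theorem leftFormula_calH10_A (hA : IntRegular A) : LeftFormula (fun P => calH10 P C) A (-2) 1 :=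
  LeftShift.leftFormula <| .mul_right <| .poch_of_intRegular hA

theorem leftFormula_calH11_A (hA : IntRegular A) :
    LeftFormula (fun P => calH11 P B C C') A (-1) 1 :=
  LeftShift.leftFormula <| .mul_right <| .mul_right <| .mul_right <| .poch_of_intRegular hA

theorem leftFormula_calH11_B (hAB : Commute A B) :
    LeftFormula (fun P => calH11 A P C C') B 0 (-1) :=
  LeftShift.leftFormula <| .mul_right <| .mul_right <| .mul_left (fun _ _ => commute_poch hAB _) <|
    .poch_of_nonneg

theorem rightFormula_calH11_C (hCC' : Commute C C') :
    RightFormula (fun P => calH11 A B P C') C 0 (-1) :=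
  RightShift.rightFormula <| .mul_right (fun _ _ => commute_inv (commute_poch hCC'.symm _)) <|
    .mul_left <| .poch_of_nonneg

end SummationFormulas

end HornMatrix

theorem mainTheorem10 (r : ℕ) :
    -- G₂
    (∀ A A' B B' : Mat r, NegRegular B → NegRegular B' →
      LeftFormula (fun P => G2 P A' B B') A (-1) 0 ∧
      (A * A' = A' * A → LeftFormula (fun P => G2 A P B B') A' 0 (-1)) ∧
      (IntRegular B → B * B' = B' * B → RightFormula (fun P => G2 A A' P B') B 1 (-1)) ∧
      (IntRegular B' → RightFormula (fun P => G2 A A' B P) B' (-1) 1)) ∧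
    -- G₃
    (∀ A A' : Mat r, NegRegular A → NegRegular A' →
      (IntRegular A → LeftFormula (fun P => G3 P A') A 1 (-2)) ∧
      (IntRegular A' → RightFormula (fun P => G3 A P) A' (-2) 1)) ∧
    -- H₁
    (∀ A B C C' : Mat r, NegRegular A → NonnegRegular C' →
      (IntRegular A → LeftFormula (fun P => H1 P B C C') A (-1) 1) ∧
      (A * B = B * A → LeftFormula (fun P => H1 A P C C') B (-1) (-1)) ∧
      (C * C' = C' * C → RightFormula (fun P => H1 A B P C') C 0 (-1))) ∧
    -- H₂
    (∀ A B C C' C'' : Mat r, NegRegular A → NonnegRegular C'' →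
      (IntRegular A → LeftFormula (fun P => H2 P B C C' C'') A (-1) 1) ∧
      (A * B = B * A → LeftFormula (fun P => H2 A P C C' C'') B (-1) 0) ∧
      (C * C' = C' * C → C * C'' = C'' * C →
        RightFormula (fun P => H2 A B P C' C'') C 0 (-1)) ∧
      (C' * C'' = C'' * C' → RightFormula (fun P => H2 A B C P C'') C' 0 (-1))) ∧
    -- H₃
    (∀ A B C : Mat r, NonnegRegular C →
      LeftFormula (fun P => H3 P B C) A (-2) (-1) ∧
      (A * B = B * A → LeftFormula (fun P => H3 A P C) B 0 (-1))) ∧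
    -- H₄
    (∀ A B C C' : Mat r, NonnegRegular C → NonnegRegular C' →
      LeftFormula (fun P => H4 P B C C') A (-2) (-1) ∧
      (A * B = B * A → LeftFormula (fun P => H4 A P C C') B 0 (-1))) ∧
    -- H₅
    (∀ A B C : Mat r, NegRegular B → NonnegRegular C →
      LeftFormula (fun P => H5 P B C) A (-2) (-1) ∧
      (IntRegular B → A * B = B * A → LeftFormula (fun P => H5 A P C) B 1 (-1))) ∧
    -- H₆
    (∀ A B C : Mat r, NegRegular A → NegRegular B →
      (IntRegular A → LeftFormula (fun P => H6 P B C) A (-2) 1) ∧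
      (IntRegular B → A * B = B * A → LeftFormula (fun P => H6 A P C) B 1 (-1))) ∧
    -- H₇
    (∀ A B C C' : Mat r, NegRegular A → NonnegRegular C' →
      (IntRegular A → LeftFormula (fun P => H7 P B C C') A (-2) 1) ∧
      (A * B = B * A → LeftFormula (fun P => H7 A P C C') B 0 (-1)) ∧
      (C * C' = C' * C → RightFormula (fun P => H7 A B P C') C 0 (-1))) ∧
    -- Γ₁
    (∀ A B B' : Mat r, NegRegular B → NegRegular B' →
      LeftFormula (fun P => Gamma1 P B B') A (-1) 0 ∧
      (IntRegular B → B * B' = B' * B → RightFormula (fun P => Gamma1 A P B') B 1 (-1)) ∧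
      (IntRegular B' → RightFormula (fun P => Gamma1 A B P) B' (-1) 1)) ∧
    -- Γ₂
    (∀ B B' : Mat r, NegRegular B → NegRegular B' →
      (IntRegular B → LeftFormula (fun P => Gamma2 P B') B 1 (-1)) ∧
      (IntRegular B' → RightFormula (fun P => Gamma2 B P) B' (-1) 1)) ∧
    -- ℋ₁
    (∀ A B C : Mat r, NegRegular A → NonnegRegular C →
      (IntRegular A → LeftFormula (fun P => calH1 P B C) A (-1) 1) ∧
      (A * B = B * A → LeftFormula (fun P => calH1 A P C) B (-1) (-1))) ∧
    -- ℋ₂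
    (∀ A B B' C : Mat r, NegRegular A → NonnegRegular C →
      (IntRegular A → LeftFormula (fun P => calH2 P B B' C) A (-1) 1) ∧
      (A * B = B * A → LeftFormula (fun P => calH2 A P B' C) B (-1) 0) ∧
      (B' * C = C * B' → RightFormula (fun P => calH2 A B P C) B' 0 (-1))) ∧
    -- ℋ₃
    (∀ A B C : Mat r, NegRegular A → NonnegRegular C →
      (IntRegular A → LeftFormula (fun P => calH3 P B C) A (-1) 1) ∧
      (A * B = B * A → LeftFormula (fun P => calH3 A P C) B (-1) 0)) ∧
    -- ℋ₄
    (∀ A B' C : Mat r, NegRegular A → NonnegRegular C →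
      (IntRegular A → LeftFormula (fun P => calH4 P B' C) A (-1) 1) ∧
      (A * B' = B' * A → LeftFormula (fun P => calH4 A P C) B' 0 (-1))) ∧
    -- ℋ₅
    (∀ A C : Mat r, IntRegular A → NonnegRegular C →
      LeftFormula (fun P => calH5 P C) A (-1) 1) ∧
    -- ℋ₆
    (∀ A C : Mat r, NonnegRegular C →
      LeftFormula (fun P => calH6 P C) A (-2) (-1)) ∧
    -- ℋ₇
    (∀ A C C' : Mat r, NonnegRegular C → NonnegRegular C' →
      LeftFormula (fun P => calH7 P C C') A (-2) (-1)) ∧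
    -- ℋ₈
    (∀ A B : Mat r, NegRegular A → NegRegular B →
      (IntRegular A → LeftFormula (fun P => calH8 P B) A (-2) 1) ∧
      (IntRegular B → RightFormula (fun P => calH8 A P) B 1 (-1))) ∧
    -- ℋ₉
    (∀ A B C : Mat r, NegRegular A → NonnegRegular C →
      (IntRegular A → LeftFormula (fun P => calH9 P B C) A (-2) 1) ∧
      (A * B = B * A → LeftFormula (fun P => calH9 A P C) B 0 (-1))) ∧
    -- ℋ₁₀
    (∀ A C : Mat r, IntRegular A → NonnegRegular C →
      LeftFormula (fun P => calH10 P C) A (-2) 1) ∧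
    -- ℋ₁₁
    (∀ A B C C' : Mat r, NegRegular A → NonnegRegular C' →
      (IntRegular A → LeftFormula (fun P => calH11 P B C C') A (-1) 1) ∧
      (A * B = B * A → LeftFormula (fun P => calH11 A P C C') B 0 (-1)) ∧
      (C * C' = C' * C → RightFormula (fun P => calH11 A B P C') C 0 (-1))) :=
  ⟨fun _ _ _ _ _ _ => ⟨leftFormula_G2_A, leftFormula_G2_A', rightFormula_G2_B, rightFormula_G2_B'⟩,
    fun _ _ _ _ => ⟨leftFormula_G3_A, rightFormula_G3_A'⟩,
    fun _ _ _ _ _ _ => ⟨leftFormula_H1_A, leftFormula_H1_B, rightFormula_H1_C⟩,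
    fun _ _ _ _ _ _ _ => ⟨leftFormula_H2_A, leftFormula_H2_B, rightFormula_H2_C,
      rightFormula_H2_C'⟩,
    fun _ _ _ _ => ⟨leftFormula_H3_A, leftFormula_H3_B⟩,
    fun _ _ _ _ _ _ => ⟨leftFormula_H4_A, leftFormula_H4_B⟩,
    fun _ _ _ _ _ => ⟨leftFormula_H5_A, leftFormula_H5_B⟩,
    fun _ _ _ _ _ => ⟨leftFormula_H6_A, leftFormula_H6_B⟩,
    fun _ _ _ _ _ _ => ⟨leftFormula_H7_A, leftFormula_H7_B, rightFormula_H7_C⟩,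
    fun _ _ _ _ _ => ⟨leftFormula_Gamma1_A, rightFormula_Gamma1_B, rightFormula_Gamma1_B'⟩,
    fun _ _ _ _ => ⟨leftFormula_Gamma2_B, rightFormula_Gamma2_B'⟩,
    fun _ _ _ _ _ => ⟨leftFormula_calH1_A, leftFormula_calH1_B⟩,
    fun _ _ _ _ _ _ => ⟨leftFormula_calH2_A, leftFormula_calH2_B, rightFormula_calH2_B'⟩,
    fun _ _ _ _ _ => ⟨leftFormula_calH3_A, leftFormula_calH3_B⟩,
    fun _ _ _ _ _ => ⟨leftFormula_calH4_A, leftFormula_calH4_B'⟩,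
    fun _ _ hA _ => leftFormula_calH5_A hA,
    fun _ _ _ => leftFormula_calH6_A,
    fun _ _ _ _ _ => leftFormula_calH7_A,
    fun _ _ _ _ => ⟨leftFormula_calH8_A, rightFormula_calH8_B⟩,
    fun _ _ _ _ _ => ⟨leftFormula_calH9_A, leftFormula_calH9_B⟩,
    fun _ _ hA _ => leftFormula_calH10_A hA,
    fun _ _ _ _ _ _ => ⟨leftFormula_calH11_A, leftFormula_calH11_B, rightFormula_calH11_C⟩⟩
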